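/- All graphs are finite, simple and undirected. A graph is Hamiltonian if it has a cycle containing all of its vertices (a Hamiltonian cycle), and chordal if it has no induced cycle of length at least $4$. For a set $\mathcal{H}$ of graphs, a graph is $\mathcal{H}$-free if it has no induced subgraph isomorphic to a member of $\mathcal{H}$. The bull is the graph on five vertices consisting of a triangle together with two pendant edges attached at two different vertices of the triangle, and $K_2 \vee P_5$ is the graph obtained from disjoint copies of $K_2$ and of the path $P_5$ on five vertices by adding all edges between them. A cycle $C$ of $G$ is extendable if $G$ has a cycle $C'$ with exactly one more vertex than $C$ such that $V(C') \setminus V(C)$ is a single vertex. The graph $G$ is fully cycle extendable if every non-Hamiltonian cycle of $G$ is extendable and every vertex of $G$ lies in a triangle. Theorem. If $G$ is a Hamiltonian chordal graph that is $\{\text{bull}, K_{1,5}\}$-free or $\{\text{bull}, K_2 \vee P_5\}$-free, then $G$ is fully cycle extendable. -/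

import Mathlib

namespace HamChordal

variable {V : Type*} {W : Type*}

/-- `G` is Hamiltonian: it has a cycle through all vertices. (Unlike `SimpleGraph.IsHamiltonian`,
this is false for the one-vertex graph, which has no cycle.) -/
def Hamiltonian [DecidableEq V] (G : SimpleGraph V) : Prop :=
  ∃ (v : V) (C : G.Walk v v), C.IsHamiltonianCycle

/-- `G` is chordal: it has no induced cycle of length at least `4`. -/
def Chordal (G : SimpleGraph V) : Prop :=
  ∀ n : ℕ, 4 ≤ n → ¬ (SimpleGraph.cycleGraph n).IsIndContained G

/-- `G` is `H`-free: no induced subgraph of `G` is isomorphic to `H`. -/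
def InducedFree (H : SimpleGraph W) (G : SimpleGraph V) : Prop :=
  ¬ H.IsIndContained G

/-- The vertex set of a closed walk. -/
def vertexSet {G : SimpleGraph V} {v : V} (C : G.Walk v v) : Set V :=
  {x | x ∈ C.support}

/-- `C'` is an extension of `C`: both are cycles, `C'` is longer by exactly one, and
`V(C') \ V(C)` consists of a single vertex. -/
def IsExtension {G : SimpleGraph V} {v w : V} (C : G.Walk v v) (C' : G.Walk w w) : Prop :=
  C.IsCycle ∧ C'.IsCycle ∧ C'.length = C.length + 1 ∧ ∃ x : V, vertexSet C' \ vertexSet C = {x}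

/-- The cycle `C` is extendable: it has an extension. -/
def Extendable {G : SimpleGraph V} {v : V} (C : G.Walk v v) : Prop :=
  ∃ (w : V) (C' : G.Walk w w), IsExtension C C'

/-- `G` is cycle extendable: every non-Hamiltonian cycle of `G` is extendable. -/
def CycleExtendable [DecidableEq V] (G : SimpleGraph V) : Prop :=
  ∀ (v : V) (C : G.Walk v v), C.IsCycle → ¬ C.IsHamiltonianCycle → Extendable C

/-- `G` is fully cycle extendable: it is cycle extendable and every vertex lies in a triangle. -/
def FullyCycleExtendable [DecidableEq V] (G : SimpleGraph V) : Prop :=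
  CycleExtendable G ∧ ∀ v : V, ∃ a b : V, G.Adj v a ∧ G.Adj v b ∧ G.Adj a b

/-- The join `G ∨ H`: the disjoint union of `G` and `H` together with all edges between them. -/
def join (G : SimpleGraph V) (H : SimpleGraph W) : SimpleGraph (V ⊕ W) :=
  SimpleGraph.sum G H ⊔ completeBipartiteGraph V W

/-- The bull: the triangle `0, 1, 2` with pendant edges `0 3` and `1 4`. -/
def bull : SimpleGraph (Fin 5) :=
  SimpleGraph.fromEdgeSet {s(0, 1), s(0, 2), s(1, 2), s(0, 3), s(1, 4)}

/-- The star `K_{1,5}`. -/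
def star15 : SimpleGraph (Fin 1 ⊕ Fin 5) :=
  completeBipartiteGraph (Fin 1) (Fin 5)

/-- The join `K_2 ∨ P_5` of an edge and the path on five vertices. -/
def K2joinP5 : SimpleGraph (Fin 2 ⊕ Fin 5) :=
  join (SimpleGraph.completeGraph (Fin 2)) (SimpleGraph.pathGraph 5)

end HamChordal

/-!
Let `S` be the vertex set of a non-Hamiltonian cycle; a cycle on `S ∪ {y}` for some `y ∉ S` is
wanted (`HamOn.exists_insert_of_hamiltonian`).

Hamiltonicity of `G` enters through simplicial vertices only: a cycle may skip a simplicial vertex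
(`HamOn.diff_simplicial`). So in a smallest vertex set `U ⊋ S` carrying a cycle, either `U \ S` is a
single vertex, or no vertex of `U \ S` is simplicial in `G[U]`. In the latter case Dirac's lemma
(`Chordal.exists_simplicial`) gives a component of `G[U \ S]` with two nonadjacent neighbours `a`,
`b` in `S`.

Take a minimal separator `Q` of `a` and `b` in `G[S]`, with components `A ∋ a` and `B ∋ b`; it is
a clique, and it has at least two vertices as `G[S]` has a Hamiltonian cycle. Outside `S` there is
a vertex `y` adjacent to `A` and to a connected set `E ⊇ B` having no edge to `A`
(`Separation.exists_bridge`). Chordality makes `Q` complete to `y`. If `S` is not extendable, then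
consecutive vertices of the cycle have no common neighbour outside `S`, and excluding bulls makes
`Q` complete to `A ∪ E` and makes `N(y) ∩ A` and `N(y) ∩ E` cliques (`Bridge.complete`). There are
adjacent `s, d ∈ A` and `d', s' ∈ E` with `d, d'` adjacent to `y` and `s, s'` not, so `s d y d' s'`
is an induced path, and with two vertices of `Q` it forms an induced `K₂ ∨ P₅`. If `A \ N(y)` were a
clique, then `G[A]` would have a Hamiltonian path starting next to `y`, and all visits of the cycle
to `A` could be replaced by a single one that also passes through `y`
(`HamOn.insert_of_path`). So `A \ N(y)`, and likewise `E \ N(y)`, contains two nonadjacent vertices;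
with `y` they are the leaves of an induced `K_{1,5}` centred at any vertex of `Q`.
-/

namespace HamChordal

variable {V : Type*}

/-! ### Connected vertex sets in chordal graphs, separators and simplicial vertices -/

/-- `Joined G X u v`: there is a walk from `u` to `v` all of whose vertices after `u` lie in `X`. -/
def Joined (G : SimpleGraph V) (X : Set V) : V → V → Prop :=
  Relation.ReflTransGen fun x y => G.Adj x y ∧ y ∈ X

/-- `X` induces a connected subgraph of `G`, or is empty. -/
def Conn (G : SimpleGraph V) (X : Set V) : Prop :=
  ∀ u ∈ X, ∀ v ∈ X, Joined G X u v

variable {G : SimpleGraph V}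

lemma Joined.mono {X Y : Set V} (hXY : X ⊆ Y) {u v : V} (h : Joined G X u v) : Joined G Y u v :=
  Relation.ReflTransGen.mono (fun _ _ h => ⟨h.1, hXY h.2⟩) _ _ h

lemma Joined.single {X : Set V} {u v : V} (h : G.Adj u v) (hv : v ∈ X) : Joined G X u v :=
  Relation.ReflTransGen.single ⟨h, hv⟩

lemma Joined.mem {X : Set V} {u v : V} (hu : u ∈ X) (h : Joined G X u v) : v ∈ X := by
  induction h with
  | refl => exact hu
  | tail _ h _ => exact h.2

lemma Joined.symm {X : Set V} {u v : V} (hu : u ∈ X) (h : Joined G X u v) : Joined G X v u := by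
  induction h with
  | refl => exact .refl
  | @tail b c hb h ih => exact .head ⟨h.1.symm, Joined.mem hu hb⟩ ih

lemma Joined.exists_crossing {X S : Set V} {u v : V} (h : Joined G X u v) (hu : u ∈ S)
    (hX : u ∈ X) (hv : v ∉ S) : ∃ x ∈ X, ∃ y ∈ X, x ∈ S ∧ y ∉ S ∧ G.Adj x y := by
  induction h with
  | refl => exact absurd hu hv
  | @tail b c hb h ih =>
    by_cases hbS : b ∈ S
    · exact ⟨b, Joined.mem hX hb, c, h.2, hbS, hv, h.1⟩
    · exact ih hbS

lemma Joined.induction_mem {X : Set V} {P : V → Prop} {u v : V} (h : Joined G X u v) (hu : P u)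
    (step : ∀ x y, y ∈ X → P x → G.Adj x y → P y) : P v := by
  induction h with
  | refl => exact hu
  | tail _ h ih => exact step _ _ h.2 ih h.1

/-- The vertices joined to `a` inside `X` induce a connected subgraph. -/
lemma conn_setOf_joined {X : Set V} {a : V} : Conn G {x | Joined G X a x} := by
  have key : ∀ v, Joined G X a v → Joined G {x | Joined G X a x} a v := by
    intro v hv
    induction hv with
    | refl => exact .refl
    | tail hb h ih => exact .tail ih ⟨h.1, .tail hb h⟩
  intro u hu v hv
  exact (Joined.symm (X := {x | Joined G X a x}) .refl (key u hu)).trans (key v hv)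

/-- In a chordal graph, two neighbours of `z` linked through non-neighbours of `z` are adjacent:
a shortest such link would close up with `z` to an induced cycle. -/
lemma Chordal.adj_of_joined (hG : Chordal G) {z u v w : V} {X : Set V} (hzu : G.Adj z u)
    (hzv : G.Adj z v) (huv : u ≠ v) (hX : ∀ x ∈ X, x ≠ z ∧ ¬ G.Adj z x) (hw : Joined G X u w)
    (hwv : G.Adj w v) : G.Adj u v := by
  by_contra hnadj
  let Y : Set V := {x | x ∈ X ∨ x = u ∨ x = v}
  let G' : SimpleGraph V :=
    { Adj := fun x y => G.Adj x y ∧ x ∈ Y ∧ y ∈ Y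
      symm := ⟨fun x y h => ⟨h.1.symm, h.2.2, h.2.1⟩⟩
      loopless := ⟨fun x h => G.loopless.irrefl x h.1⟩ }
  have hr : ∀ x, Joined G X u x → G'.Reachable u x ∧ x ∈ Y := by
    intro x hx
    induction hx with
    | refl => exact ⟨.refl _, .inr (.inl rfl)⟩
    | tail hb h ih =>
      have hc : _ ∈ Y := .inl h.2
      exact ⟨ih.1.trans (SimpleGraph.Adj.reachable (G := G') ⟨h.1, ih.2, hc⟩), hc⟩
  have hreach : G'.Reachable u v :=
    (hr w hw).1.trans (SimpleGraph.Adj.reachable (G := G') ⟨hwv, (hr w hw).2, .inr (.inr rfl)⟩)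
  obtain ⟨p, hp⟩ := hreach.exists_walk_length_eq_dist
  set n := p.length with hn
  have hdist : ∀ i ≤ n, G'.dist u (p.getVert i) = i := by
    intro i hi
    have h1 : G'.dist u (p.getVert i) ≤ i := by
      refine (SimpleGraph.dist_le (p.take i)).trans ?_
      simp
    have h2 : G'.dist (p.getVert i) v ≤ n - i := by
      refine (SimpleGraph.dist_le (p.drop i)).trans ?_
      simp [hn]
    have h3 : G'.dist u v ≤ G'.dist u (p.getVert i) + G'.dist (p.getVert i) v :=
      SimpleGraph.Reachable.dist_triangle_left (p.take i).reachable v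
    omega
  have hY : ∀ i ≤ n, p.getVert i ∈ Y := by
    intro i hi
    rcases Nat.eq_zero_or_pos i with rfl | h0
    · rw [p.getVert_zero]; exact .inr (.inl rfl)
    · have := p.adj_getVert_succ (i := i - 1) (by omega)
      rw [Nat.sub_add_cancel h0] at this
      exact this.2.2
  have h2n : 2 ≤ n := by
    by_contra hlt
    have : n = 0 ∨ n = 1 := by omega
    rcases this with h | h
    · exact huv (SimpleGraph.Walk.eq_of_length_eq_zero h)
    · exact hnadj ((SimpleGraph.dist_eq_one_iff_adj.mp (hp.symm.trans h)).1)
  -- along a shortest walk only consecutive vertices are adjacent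
  have hadj : ∀ i ≤ n, ∀ j ≤ n, (G.Adj (p.getVert i) (p.getVert j) ↔ i + 1 = j ∨ j + 1 = i) := by
    intro i hi j hj
    constructor
    · intro h
      have h' : G'.Adj (p.getVert i) (p.getVert j) := ⟨h, hY i hi, hY j hj⟩
      have hne : i ≠ j := by rintro rfl; exact G.loopless.irrefl _ h
      have d1 := h'.reachable.dist_triangle_right u
      have d2 := h'.symm.reachable.dist_triangle_right u
      rw [SimpleGraph.dist_eq_one_iff_adj.mpr h', hdist i hi, hdist j hj] at d1
      rw [SimpleGraph.dist_eq_one_iff_adj.mpr h'.symm, hdist i hi, hdist j hj] at d2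
      omega
    · rintro (rfl | rfl)
      · exact (p.adj_getVert_succ (by omega)).1
      · exact (p.adj_getVert_succ (by omega)).1.symm
  have hinj : ∀ i ≤ n, ∀ j ≤ n, p.getVert i = p.getVert j → i = j := by
    intro i hi j hj h
    rw [← hdist i hi, h, hdist j hj]
  have hz : ∀ i ≤ n, p.getVert i ≠ z ∧ (G.Adj z (p.getVert i) ↔ i = 0 ∨ i = n) := by
    intro i hi
    have e0 : p.getVert 0 = u := p.getVert_zero
    have en : p.getVert n = v := p.getVert_length
    rcases hY i hi with h | h | h
    · refine ⟨(hX _ h).1, fun h' => absurd h' (hX _ h).2, ?_⟩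
      rintro (rfl | rfl)
      · rwa [e0]
      · rwa [en]
    · have : i = 0 := hinj i hi 0 (by omega) (h.trans e0.symm)
      subst this
      rw [e0]
      exact ⟨fun e => G.loopless.irrefl z (e ▸ hzu), by simp [hzu]⟩
    · have : i = n := hinj i hi n le_rfl (h.trans en.symm)
      subst this
      rw [en]
      exact ⟨fun e => G.loopless.irrefl z (e ▸ hzv), by simp [hzv]⟩
  obtain ⟨f, hf⟩ : ∃ f : Fin (n + 2) → V, ∀ i, f i = if i.val ≤ n then p.getVert i.val else z :=
    ⟨_, fun _ => rfl⟩
  refine hG (n + 2) (by omega) ⟨⟨⟨f, ?_⟩, ?_⟩⟩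
  · intro i j hij
    have hi := i.isLt
    have hj := j.isLt
    rw [hf, hf] at hij
    apply Fin.ext
    split_ifs at hij with h1 h2 h2
    · exact hinj _ h1 _ h2 hij
    · exact absurd hij (hz _ h1).1
    · exact absurd hij.symm (hz _ h2).1
    · omega
  · intro i j
    have hi := i.isLt
    have hj := j.isLt
    rw [SimpleGraph.cycleGraph_adj']
    change G.Adj (f i) (f j) ↔ _
    rw [hf, hf]
    have hsub : ∀ a b : Fin (n + 2), (a - b).val = 1 ↔
        (a.val = b.val + 1 ∨ (a.val = 0 ∧ b.val = n + 1)) := by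
      intro a b
      have ha := a.isLt
      have hb := b.isLt
      rw [Fin.val_sub]
      rcases lt_or_ge a.val b.val with h | h
      · rw [Nat.mod_eq_of_lt (by omega)]; omega
      · rw [show n + 2 - b.val + a.val = (a.val - b.val) + (n + 2) by omega, Nat.add_mod_right,
          Nat.mod_eq_of_lt (by omega)]; omega
    rw [hsub, hsub]
    split_ifs with h1 h2 h2
    · rw [hadj _ h1 _ h2]; omega
    · rw [G.adj_comm, (hz _ h1).2]; omega
    · rw [(hz _ h2).2]; omega
    · have := G.loopless.irrefl z
      simp only [this, false_iff]; omega

/-- In a chordal graph, the neighbours of `z` inside a connected set avoiding `z` are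
connected among themselves. -/
lemma Chordal.conn_inter_neighborSet (hG : Chordal G) {z : V} {X : Set V} (hX : Conn G X)
    (hz : z ∉ X) : Conn G (X ∩ G.neighborSet z) := by
  intro u hu v hv
  -- `l` is the last neighbour of `z` met so far on the way from `u`
  have key : ∀ w, Joined G X u w → ∃ l ∈ X ∩ G.neighborSet z,
      Joined G (X ∩ G.neighborSet z) u l ∧ Joined G {x ∈ X | ¬ G.Adj z x} l w := by
    intro w hw
    induction hw with
    | refl => exact ⟨u, hu, .refl, .refl⟩
    | @tail b c _ h ih =>
      obtain ⟨l, hl, h1, h2⟩ := ih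
      by_cases hc : G.Adj z c
      · refine ⟨c, ⟨h.2, hc⟩, ?_, .refl⟩
        by_cases hlc : l = c
        · exact hlc ▸ h1
        · refine h1.tail ⟨?_, h.2, hc⟩
          exact hG.adj_of_joined hl.2 hc hlc (fun x hx => ⟨fun e => hz (e ▸ hx.1), hx.2⟩) h2 h.1
      · exact ⟨l, hl, h1, h2.tail ⟨h.1, h.2, hc⟩⟩
  obtain ⟨l, hl, h1, h2⟩ := key v (hX u hu.1 v hv.1)
  rcases Relation.ReflTransGen.cases_tail h2 with h | ⟨b, _, h⟩
  · exact h ▸ h1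
  · exact absurd hv.2 h.2.2

lemma Chordal.not_square (hG : Chordal G) {a b c d : V} (hab : G.Adj a b) (hbc : G.Adj b c)
    (hcd : G.Adj c d) (hda : G.Adj d a) (hac : ¬ G.Adj a c) (hbd : ¬ G.Adj b d)
    (hne : b ≠ d) (hne' : a ≠ c) : False :=
  hbd <| hG.adj_of_joined (X := {c}) hab hda.symm hne
    (fun x hx => by rw [Set.mem_singleton_iff.mp hx]; exact ⟨hne'.symm, hac⟩)
    (Joined.single hbc rfl) hcd

/-- A minimal separation of two nonadjacent vertices `a` and `b` of `G[W]`: `A` and `B` are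
components of `G[W \ Q]` containing `a` and `b`, every vertex of the clique `Q` has neighbours in
both of them. -/
structure Separation (G : SimpleGraph V) (W A B Q : Set V) (a b : V) : Prop where
  mem_left : a ∈ A
  mem_right : b ∈ B
  left_sub : A ⊆ W
  right_sub : B ⊆ W
  sep_sub : Q ⊆ W
  conn_left : Conn G A
  conn_right : Conn G B
  left_nbr : ∀ x ∈ A, ∀ w ∈ W, G.Adj x w → w ∈ A ∨ w ∈ Q
  right_nbr : ∀ x ∈ B, ∀ w ∈ W, G.Adj x w → w ∈ B ∨ w ∈ Q
  left_sep : ∀ x ∈ A, x ∉ Q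
  right_sep : ∀ x ∈ B, x ∉ Q
  disj : ∀ x ∈ A, x ∉ B
  anti : ∀ x ∈ A, ∀ y ∈ B, ¬ G.Adj x y
  clique : ∀ p ∈ Q, ∀ q ∈ Q, p ≠ q → G.Adj p q
  nbr_left : ∀ q ∈ Q, ∃ x ∈ A, G.Adj q x
  nbr_right : ∀ q ∈ Q, ∃ x ∈ B, G.Adj q x

/-- `A` is the component of `a` in `G[W]` minus the neighbours of `b`, and `Q` is its boundary. -/
lemma Chordal.exists_separation (hG : Chordal G) {W : Set V} {a b : V} (ha : a ∈ W) (hb : b ∈ W)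
    (hab : ¬ G.Adj a b) (hne : a ≠ b) : ∃ A B Q, Separation G W A B Q a b := by
  let X : Set V := {x ∈ W | ¬ G.Adj b x}
  let A : Set V := {x | Joined G X a x}
  let Q : Set V := {w ∈ W | w ∉ A ∧ ∃ x ∈ A, G.Adj x w}
  let B : Set V := {x | Joined G (W \ Q) b x}
  have haX : a ∈ X := ⟨ha, fun h => hab h.symm⟩
  have hAX : ∀ x ∈ A, x ∈ X := fun x hx => Joined.mem haX hx
  have hbA : ∀ x ∈ A, x ≠ b := by
    intro x hx
    rcases Relation.ReflTransGen.cases_tail hx with h | ⟨c, hc, h⟩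
    · exact h ▸ hne
    · rintro rfl
      exact (hAX c hc).2 h.1.symm
  have hQb : ∀ q ∈ Q, G.Adj b q := by
    rintro q ⟨hqW, hqA, x, hx, hxq⟩
    by_contra h
    exact hqA (Relation.ReflTransGen.tail hx ⟨hxq, hqW, h⟩)
  have hbQ : b ∈ W \ Q := ⟨hb, fun h => G.loopless.irrefl b (hQb b h)⟩
  have hBW : ∀ x ∈ B, x ∈ W \ Q := fun x hx => Joined.mem hbQ hx
  have hBA : ∀ x ∈ B, x ∉ A := by
    intro x hx
    refine (Joined.induction_mem (P := fun x => x ∈ W \ Q ∧ x ∉ A) hx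
      ⟨hbQ, fun h => hbA b h rfl⟩ ?_).2
    exact fun x y hy hx hxy => ⟨hy, fun hyA => hx.1.2 ⟨hx.1.1, hx.2, y, hyA, hxy.symm⟩⟩
  have hAQ : ∀ x ∈ A, x ∉ Q := fun x hx h => h.2.1 hx
  have hleft : ∀ x ∈ A, ∀ w ∈ W, G.Adj x w → w ∈ A ∨ w ∈ Q := fun x hx w hw h =>
    or_iff_not_imp_left.mpr fun hwA => ⟨hw, hwA, x, hx, h⟩
  refine ⟨A, B, Q, .refl, .refl, fun x hx => (hAX x hx).1, fun x hx => (hBW x hx).1,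
    fun x hx => hx.1, conn_setOf_joined, conn_setOf_joined, hleft, ?_, hAQ,
    fun x hx => (hBW x hx).2, fun x hx h => hBA x h hx, ?_, ?_, ?_,
    fun q hq => ⟨b, .refl, (hQb q hq).symm⟩⟩
  · exact fun x hx w hw h =>
      or_iff_not_imp_right.mpr fun hwQ => Relation.ReflTransGen.tail hx ⟨h, hw, hwQ⟩
  · intro x hx y hy h
    rcases hleft x hx y (hBW y hy).1 h with h | h
    · exact hBA y hy h
    · exact (hBW y hy).2 h
  · rintro p hp q hq hpq
    obtain ⟨x, hx, hxp⟩ := hp.2.2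
    obtain ⟨x', hx', hxq⟩ := hq.2.2
    refine hG.adj_of_joined (hQb p hp) (hQb q hq) hpq (X := A)
      (fun x hx => ⟨hbA x hx, (hAX x hx).2⟩) ?_ hxq
    exact Relation.ReflTransGen.head ⟨hxp.symm, hx⟩ (conn_setOf_joined x hx x' hx')
  · rintro q hq
    obtain ⟨x, hx, hxq⟩ := hq.2.2
    exact ⟨x, hx, hxq.symm⟩

/-- Dirac's lemma on simplicial vertices, relative to a vertex set `W`: a nonempty `K ⊆ W` whose
boundary in `G[W]` is a clique contains a vertex that is simplicial in `G[W]`. -/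
lemma Chordal.exists_simplicial [Finite V] (hG : Chordal G) {W K : Set V} (hKW : K ⊆ W)
    (hK : K.Nonempty)
    (hcl : ∀ p ∈ W \ K, ∀ q ∈ W \ K, (∃ x ∈ K, G.Adj x p) → (∃ x ∈ K, G.Adj x q) → p ≠ q →
      G.Adj p q) :
    ∃ s ∈ K, ∀ p ∈ W, ∀ q ∈ W, G.Adj s p → G.Adj s q → p ≠ q → G.Adj p q := by
  induction hn : K.ncard using Nat.strong_induction_on generalizing K with
  | _ n ih =>
  subst hn
  let W' : Set V := {x ∈ W | x ∈ K ∨ ∃ y ∈ K, G.Adj y x}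
  by_cases hall : ∀ u ∈ K, ∀ v ∈ W', u ≠ v → G.Adj u v
  · obtain ⟨s, hs⟩ := hK
    refine ⟨s, hs, fun p hp q hq hsp hsq hpq => ?_⟩
    by_cases hpK : p ∈ K
    · exact hall p hpK q ⟨hq, .inr ⟨s, hs, hsq⟩⟩ hpq
    by_cases hqK : q ∈ K
    · exact (hall q hqK p ⟨hp, .inr ⟨s, hs, hsp⟩⟩ hpq.symm).symm
    exact hcl p ⟨hp, hpK⟩ q ⟨hq, hqK⟩ ⟨s, hs, hsp⟩ ⟨s, hs, hsq⟩ hpq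
  push Not at hall
  obtain ⟨u, hu, v, hv, huv, hnadj⟩ := hall
  obtain ⟨A, B, Q, h⟩ := hG.exists_separation (W := W') ⟨hKW hu, .inl hu⟩ hv hnadj huv
  -- a side of the separation that lies inside `K` is smaller and has its boundary in `Q`
  have key : ∀ D : Set V, D ⊆ K → D ≠ K → D.Nonempty →
      (∀ x ∈ D, ∀ w ∈ W', G.Adj x w → w ∈ D ∨ w ∈ Q) →
      ∃ s ∈ K, ∀ p ∈ W, ∀ q ∈ W, G.Adj s p → G.Adj s q → p ≠ q → G.Adj p q := by
    intro D hDK hne hD hnbr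
    have hbd : ∀ p ∈ W \ D, (∃ x ∈ D, G.Adj x p) → p ∈ Q := by
      rintro p hp ⟨x, hx, hxp⟩
      exact (hnbr x hx p ⟨hp.1, .inr ⟨x, hDK hx, hxp⟩⟩ hxp).resolve_left hp.2
    obtain ⟨s, hs, h'⟩ := ih D.ncard (Set.ncard_lt_ncard (hDK.ssubset_of_ne hne))
      (hDK.trans hKW) hD
      (fun p hp q hq hxp hxq => h.clique p (hbd p hp hxp) q (hbd q hq hxq)) rfl
    exact ⟨s, hDK hs, h'⟩
  have hnb : ∀ x ∈ W', x ∉ K → ∃ y ∈ K, G.Adj y x := fun x hx hxK => hx.2.resolve_left hxK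
  by_cases hAK : A ⊆ K
  · refine key A hAK ?_ ⟨u, h.mem_left⟩ h.left_nbr
    rintro rfl
    by_cases hvK : v ∈ A
    · exact h.disj v hvK h.mem_right
    · obtain ⟨y, hy, hyv⟩ := hnb v hv hvK
      exact h.anti y hy v h.mem_right hyv
  · obtain ⟨c, hcA, hcK⟩ := Set.not_subset.mp hAK
    refine key B (fun d hdB => ?_) ?_ ⟨v, h.mem_right⟩ h.right_nbr
    · by_contra hdK
      have hc := h.left_sub hcA
      have hd := h.right_sub hdB
      exact h.anti c hcA d hdB (hcl c ⟨hc.1, hcK⟩ d ⟨hd.1, hdK⟩ (hnb c hc hcK) (hnb d hd hdK)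
        (fun e => h.disj c hcA (e ▸ hdB)))
    · rintro rfl
      exact h.disj u h.mem_left hu

/-! ### Cyclic lists and their modifications -/

/-- The vertex set `S` carries a cycle of `G`; the cycle is given as a list of its vertices,
starting at some vertex `a` and closing up after its last entry. -/
def HamOn (G : SimpleGraph V) (S : Set V) : Prop :=
  ∃ a l, (a :: l).Nodup ∧ 2 ≤ l.length ∧ List.IsChain G.Adj (a :: (l ++ [a])) ∧
    ∀ x, x ∈ a :: l ↔ x ∈ S

/-- The list of a cycle can be chosen to start at any vertex. -/
lemma HamOn.exists_list {S : Set V} (h : HamOn G S) {b : V} (hb : b ∈ S) :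
    ∃ l, (b :: l).Nodup ∧ 2 ≤ l.length ∧ List.IsChain G.Adj (b :: (l ++ [b])) ∧
      ∀ x, x ∈ b :: l ↔ x ∈ S := by
  obtain ⟨a, l, hnd, hlen, hch, hmem⟩ := h
  rcases List.mem_cons.mp ((hmem b).mpr hb) with rfl | hbl
  · exact ⟨l, hnd, hlen, hch, hmem⟩
  obtain ⟨l₁, l₂, rfl⟩ := List.append_of_mem hbl
  have hperm : (b :: (l₂ ++ a :: l₁)).Perm (a :: (l₁ ++ b :: l₂)) :=
    List.perm_append_comm (l₁ := b :: l₂) (l₂ := a :: l₁)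
  refine ⟨l₂ ++ a :: l₁, hperm.nodup_iff.mpr hnd, ?_, ?_, fun x => hperm.mem_iff.trans (hmem x)⟩
  · simp only [List.length_append, List.length_cons] at hlen ⊢
    omega
  · have e : a :: (l₁ ++ b :: l₂ ++ [a]) = (a :: l₁) ++ b :: (l₂ ++ [a]) := by simp
    rw [e, List.isChain_split] at hch
    have e' : b :: (l₂ ++ a :: l₁ ++ [b]) = (b :: l₂) ++ a :: (l₁ ++ [b]) := by simp
    rw [e', List.isChain_split]
    exact ⟨hch.2, hch.1⟩

/-- Every vertex of a cycle has a neighbour on it such that a common neighbour of both outside the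
cycle could be inserted between the two. -/
lemma HamOn.exists_next {S : Set V} (h : HamOn G S) {v : V} (hv : v ∈ S) :
    ∃ c ∈ S, G.Adj v c ∧ ∀ y ∉ S, G.Adj y v → G.Adj y c → HamOn G (insert y S) := by
  obtain ⟨l, hnd, hlen, hch, hmem⟩ := h.exists_list hv
  match l, hlen with
  | c :: l, hlen =>
    rw [List.cons_append, List.isChain_cons_cons] at hch
    refine ⟨c, (hmem c).mp (by simp), hch.1, fun y hy hyv hyc => ⟨v, y :: c :: l, ?_, ?_, ?_, ?_⟩⟩
    · have hy' : y ∉ v :: c :: l := fun h => hy ((hmem y).mp h)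
      exact ((List.Perm.swap v y _).nodup_iff).mp (List.nodup_cons.mpr ⟨hy', hnd⟩)
    · simp
    · simp only [List.cons_append, List.isChain_cons_cons]
      exact ⟨hyv.symm, hyc, hch.2⟩
    · intro x
      rw [Set.mem_insert_iff, ← hmem]
      simp only [List.mem_cons]
      tauto

/-- A cycle as a list starting at `v` has distinct neighbours of `v` at its two ends. -/
lemma HamOn.exists_two {S : Set V} (h : HamOn G S) {v : V} (hv : v ∈ S) :
    ∃ c d m, c ≠ d ∧ G.Adj v c ∧ G.Adj v d ∧ (v :: c :: (m ++ [d])).Nodup ∧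
      List.IsChain G.Adj (c :: (m ++ [d])) ∧ ∀ x, x ∈ v :: c :: (m ++ [d]) ↔ x ∈ S := by
  obtain ⟨l, hnd, hlen, hch, hmem⟩ := h.exists_list hv
  match l, hlen with
  | c :: l, hlen =>
    rcases List.eq_nil_or_concat l with rfl | ⟨m, d, rfl⟩
    · simp at hlen
    rw [List.concat_eq_append] at *
    rw [List.cons_append, List.isChain_cons_cons, List.append_assoc, ← List.cons_append,
      List.singleton_append, List.isChain_split] at hch
    refine ⟨c, d, m, ?_, hch.1, ?_, hnd, hch.2.1, hmem⟩
    · rintro rfl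
      simp at hnd
    · exact (List.isChain_pair.mp hch.2.2).symm

/-- A simplicial vertex can be skipped by a cycle. -/
lemma HamOn.diff_simplicial {S : Set V} (h : HamOn G S) {s : V} (hs : s ∈ S)
    (hcard : 4 ≤ S.ncard)
    (hsimp : ∀ p ∈ S, ∀ q ∈ S, G.Adj s p → G.Adj s q → p ≠ q → G.Adj p q) :
    HamOn G (S \ {s}) := by
  classical
  obtain ⟨c, d, m, hcd, hsc, hsd, hnd, hch, hmem⟩ := h.exists_two hs
  have hS : S = ((s :: c :: (m ++ [d])).toFinset : Set V) := by
    ext x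
    rw [← hmem]
    simp only [List.coe_toFinset, Set.mem_ofPred_eq]
  rw [hS, Set.ncard_coe_finset, List.toFinset_card_of_nodup hnd] at hcard
  simp only [List.length_cons, List.length_append, List.length_nil] at hcard
  refine ⟨c, m ++ [d], (List.nodup_cons.mp hnd).2, ?_, ?_, ?_⟩
  · simp only [List.length_append, List.length_cons, List.length_nil]
    omega
  · rw [List.append_assoc, List.singleton_append, ← List.cons_append, List.isChain_split]
    refine ⟨hch, List.isChain_pair.mpr ?_⟩
    exact (hsimp c ((hmem c).mp (by simp)) d ((hmem d).mp (by simp)) hsc hsd hcd).symm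
  · intro x
    have hsm := (List.nodup_cons.mp hnd).1
    rw [Set.mem_sdiff, ← hmem, Set.mem_singleton_iff]
    exact ⟨fun hx => ⟨List.mem_cons_of_mem _ hx, fun e => hsm (e ▸ hx)⟩,
      fun hx => (List.mem_cons.mp hx.1).resolve_left hx.2⟩

lemma joined_of_isChain {X : Set V} {x : V} {l : List V} (h : List.IsChain G.Adj (x :: l))
    (hl : ∀ y ∈ l, y ∈ X) {v : V} (hv : v ∈ x :: l) : Joined G X x v := by
  induction l generalizing x with
  | nil => rw [List.mem_singleton.mp hv]; exact .refl
  | cons c l ih =>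
    rw [List.isChain_cons_cons] at h
    rcases List.mem_cons.mp hv with rfl | hv
    · exact .refl
    · exact .head ⟨h.1, hl c (by simp)⟩ (ih h.2 (fun y hy => hl y (by simp [hy])) hv)

/-- A cycle stays connected when a vertex is removed. -/
lemma HamOn.conn_diff {S : Set V} (h : HamOn G S) (q : V) : Conn G (S \ {q}) := by
  have key : ∀ c l, List.IsChain G.Adj (c :: l) → (∀ x, x ∈ c :: l ↔ x ∈ S \ {q}) →
      Conn G (S \ {q}) := by
    intro c l hch hmem u hu v hv
    have hl : ∀ y ∈ l, y ∈ S \ {q} := fun y hy => (hmem y).mp (by simp [hy])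
    exact (Joined.symm ((hmem c).mp (by simp)) (joined_of_isChain hch hl ((hmem u).mpr hu))).trans
      (joined_of_isChain hch hl ((hmem v).mpr hv))
  by_cases hq : q ∈ S
  · obtain ⟨c, d, m, -, -, -, hnd, hch, hmem⟩ := h.exists_two hq
    refine key c _ hch fun x => ?_
    have hqm := (List.nodup_cons.mp hnd).1
    rw [Set.mem_sdiff, ← hmem, Set.mem_singleton_iff]
    exact ⟨fun hx => ⟨List.mem_cons_of_mem _ hx, fun e => hqm (e ▸ hx)⟩,
      fun hx => (List.mem_cons.mp hx.1).resolve_left hx.2⟩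
  · obtain ⟨a, l, -, -, hch, hmem⟩ := h
    refine key a l ?_ fun x => ?_
    · rw [← List.cons_append, List.isChain_append] at hch
      exact hch.1
    · rw [Set.sdiff_singleton_eq_self hq, hmem]

/-- A set separating two parts of a cycle contains at least two vertices. -/
lemma HamOn.exists_pair {S A Q : Set V} (h : HamOn G S) {a b : V} (ha : a ∈ A) (haS : a ∈ S)
    (hb : b ∈ S) (hbA : b ∉ A) (hbQ : b ∉ Q) (haQ : a ∉ Q)
    (hA : ∀ x ∈ A, ∀ w ∈ S, G.Adj x w → w ∈ A ∨ w ∈ Q) :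
    ∃ p ∈ Q, ∃ q ∈ Q, p ≠ q := by
  have key : ∀ q, q ≠ a → q ≠ b → ∃ p ∈ Q, p ≠ q := by
    intro q hqa hqb
    have haX : a ∈ S \ {q} := ⟨haS, hqa.symm⟩
    obtain ⟨x, hx, y, hy, hxA, hyA, hxy⟩ :=
      (h.conn_diff q a haX b ⟨hb, hqb.symm⟩).exists_crossing ha haX hbA
    exact ⟨y, (hA x hxA y hy.1 hxy).resolve_left hyA, hy.2⟩
  obtain ⟨c, d, m, hcd, hac, had, -, -, hmem⟩ := h.exists_two haS
  obtain ⟨q₀, hqa, hqb⟩ : ∃ q₀, q₀ ≠ a ∧ q₀ ≠ b := by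
    by_cases hcb : c = b
    · exact ⟨d, had.ne', fun e => hcd (hcb.trans e.symm)⟩
    · exact ⟨c, hac.ne', hcb⟩
  obtain ⟨p, hp, -⟩ := key q₀ hqa hqb
  obtain ⟨q, hq, hqp⟩ := key p (fun e => haQ (e ▸ hp)) (fun e => hbQ (e ▸ hp))
  exact ⟨p, hp, q, hq, hqp.symm⟩

/-- Deleting from a chain the vertices of a set `A`, whose neighbours outside `A` all lie in a
clique `Q`, leaves a chain. The start `z` of the new chain is either the old start, or stands in
for deleted vertices and is adjacent to all of `Q`. -/
lemma isChain_filter {S A Q : Set V} [DecidablePred (· ∉ A)]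
    (hA : ∀ x ∈ A, ∀ w ∈ S, G.Adj x w → w ∈ A ∨ w ∈ Q)
    (hQ : ∀ p ∈ Q, ∀ q ∈ Q, p ≠ q → G.Adj p q) {l : List V} (hl : ∀ x ∈ l, x ∈ S) {x z : V}
    (hxS : x ∈ S) (hnd : (x :: l).Nodup) (hch : List.IsChain G.Adj (x :: l))
    (hz : (x = z ∧ z ∉ A) ∨ (x ∈ A ∧ ∀ w ∈ Q, w ∈ l → G.Adj z w)) :
    List.IsChain G.Adj (z :: l.filter (· ∉ A)) := by
  induction l generalizing x z with
  | nil => exact List.isChain_singleton _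
  | cons w l ih =>
    rw [List.isChain_cons_cons] at hch
    have hwS : w ∈ S := hl w (by simp)
    have hl' : ∀ x ∈ l, x ∈ S := fun x hx => hl x (by simp [hx])
    have hnd' := (List.nodup_cons.mp hnd).2
    by_cases hwA : w ∈ A
    · rw [List.filter_cons_of_neg (by simpa using hwA)]
      refine ih hl' hwS hnd' hch.2 (.inr ⟨hwA, fun p hp hpl => ?_⟩)
      rcases hz with ⟨rfl, hzA⟩ | ⟨-, hz⟩
      · have hxQ := (hA w hwA x hxS hch.1.symm).resolve_left hzA
        refine hQ x hxQ p hp ?_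
        rintro rfl
        exact (List.nodup_cons.mp hnd).1 (by simp [hpl])
      · exact hz p hp (by simp [hpl])
    · rw [List.filter_cons_of_pos (by simpa using hwA), List.isChain_cons_cons]
      refine ⟨?_, ih hl' hwS hnd' hch.2 (.inl ⟨rfl, hwA⟩)⟩
      rcases hz with ⟨rfl, -⟩ | ⟨hxA, hz⟩
      · exact hch.1
      · exact hz w ((hA x hxA w hwS hch.1).resolve_left hwA) (by simp)

/-- Rerouting: if the part `A` of a cycle is attached to the rest through a clique `Q` that is
complete to `A` and to an outside vertex `y`, and `G[A]` has a Hamiltonian path starting at a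
neighbour of `y`, then all visits of the cycle to `A` can be replaced by a single visit traversing
`y` and that path. -/
lemma HamOn.insert_of_path {S A Q : Set V} (h : HamOn G S) (hAS : A ⊆ S)
    (hA : ∀ x ∈ A, ∀ w ∈ S, G.Adj x w → w ∈ A ∨ w ∈ Q)
    (hQ : ∀ p ∈ Q, ∀ q ∈ Q, p ≠ q → G.Adj p q) (hAne : A.Nonempty) {b : V} (hb : b ∈ S)
    (hbA : b ∉ A) {y : V} (hy : y ∉ S) (hQy : ∀ q ∈ Q, G.Adj q y)
    (hQA : ∀ q ∈ Q, ∀ x ∈ A, G.Adj q x) {c : V} {P : List V} (hP : (c :: P).Nodup)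
    (hPA : ∀ x, x ∈ c :: P ↔ x ∈ A) (hPch : List.IsChain G.Adj (c :: P)) (hyc : G.Adj y c) :
    HamOn G (insert y S) := by
  classical
  obtain ⟨a₀, ha₀⟩ := hAne
  obtain ⟨l, hnd, -, hch, hmem⟩ := h.exists_list hb
  have ha₀l : a₀ ∈ l :=
    (List.mem_cons.mp ((hmem a₀).mpr (hAS ha₀))).resolve_left (fun e => hbA (e ▸ ha₀))
  -- `a` is the first vertex of `A` on the cycle, so its predecessor `q` lies in `Q`
  obtain ⟨l₁, a, l₂, rfl, hl₁, ha⟩ : ∃ l₁ a l₂, l = l₁ ++ a :: l₂ ∧ (∀ x ∈ l₁, x ∉ A) ∧ a ∈ A := by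
    clear hnd hch hmem
    induction l with
    | nil => simp at ha₀l
    | cons w l ih =>
      by_cases hw : w ∈ A
      · exact ⟨[], w, l, rfl, by simp, hw⟩
      · obtain ⟨l₁, a, l₂, e, h1, h2⟩ :=
          ih ((List.mem_cons.mp ha₀l).resolve_left (fun e => hw (e ▸ ha₀)))
        refine ⟨w :: l₁, a, l₂, by rw [e]; rfl, ?_, h2⟩
        intro x hx
        rcases List.mem_cons.mp hx with rfl | hx
        · exact hw
        · exact h1 x hx
  have hS : ∀ x, x ∈ S ↔ (x = b ∨ x ∈ l₁ ∨ x = a ∨ x ∈ l₂) := by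
    intro x
    rw [← hmem]
    simp
  rw [List.nodup_cons, List.nodup_append, List.nodup_cons] at hnd
  have e : b :: (l₁ ++ a :: l₂ ++ [b]) = (b :: l₁) ++ a :: (l₂ ++ [b]) := by simp
  rw [e, List.isChain_append] at hch
  obtain ⟨hch₁, hch₂, hlast⟩ := hch
  have hbl₁ : ∀ x ∈ b :: l₁, x ∉ A ∧ x ∈ S := by
    intro x hx
    rcases List.mem_cons.mp hx with rfl | hx
    · exact ⟨hbA, hb⟩
    · exact ⟨hl₁ x hx, (hS x).mpr (by simp [hx])⟩
  have hbl₂ : ∀ x ∈ l₂ ++ [b], x ∈ S := by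
    intro x hx
    rw [hS]
    simp only [List.mem_append, List.mem_singleton] at hx
    tauto
  have hqQ : ∀ q ∈ (b :: l₁).getLast?, q ∈ Q := by
    intro q hq
    have hq' := hbl₁ q (List.mem_of_getLast? hq)
    exact (hA a ha q hq'.2 (hlast q hq a (by simp)).symm).resolve_left hq'.1
  have hfilter : ∀ p ∈ A, List.IsChain G.Adj (p :: ((l₂ ++ [b]).filter (· ∉ A))) := by
    intro p hp
    refine isChain_filter hA hQ hbl₂ (hAS ha) ?_ hch₂
      (.inr ⟨ha, fun w hw _ => (hQA w hw p hp).symm⟩)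
    have hab : b ∉ a :: l₂ := fun h => hnd.1 (by simp [List.mem_cons.mp h])
    exact ((List.perm_append_singleton b (a :: l₂)).nodup_iff).mpr
      (List.nodup_cons.mpr ⟨hab, List.nodup_cons.mpr hnd.2.2.1⟩)
  have hfb : (l₂ ++ [b]).filter (· ∉ A) = l₂.filter (· ∉ A) ++ [b] := by
    rw [List.filter_append, List.filter_singleton]
    simp [hbA]
  have hyA : y ∉ A := fun h => hy (hAS h)
  refine ⟨b, l₁ ++ (y :: c :: P) ++ l₂.filter (· ∉ A), ?_, ?_, ?_, ?_⟩
  · have hPA' : ∀ x ∈ c :: P, x ∈ A := fun x hx => (hPA x).mp hx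
    have hyS := (hS y).not.mp hy
    push Not at hyS
    have hyP : y ∉ c :: P := fun h => hyA (hPA' y h)
    have hbP : b ∉ c :: P := fun h => hbA (hPA' b h)
    have hP1 : ∀ x ∈ l₁, x ∉ c :: P := fun x hx h => hl₁ x hx (hPA' x h)
    rw [List.nodup_cons, List.nodup_append, List.nodup_append, List.nodup_cons]
    refine ⟨?_, ⟨hnd.2.1, ⟨hyP, hP⟩, ?_⟩, hnd.2.2.1.2.filter _, ?_⟩
    · intro hx
      rw [List.mem_append, List.mem_append, List.mem_cons, List.mem_filter] at hx
      rcases hx with (hx | rfl | hx) | hx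
      · exact hnd.1 (by simp [hx])
      · exact hy hb
      · exact hbP hx
      · exact hnd.1 (by simp [hx.1])
    · rintro x hx z hz rfl
      rcases List.mem_cons.mp hz with rfl | hz
      · exact hyS.2.1 hx
      · exact hP1 x hx hz
    · rintro x hx z hz rfl
      rw [List.mem_filter, decide_eq_true_eq] at hz
      rw [List.mem_append, List.mem_cons] at hx
      rcases hx with hx | rfl | hx
      · exact hnd.2.2.2 x hx x (List.mem_cons_of_mem _ hz.1) rfl
      · exact hyS.2.2.2 hz.1
      · exact hz.2 (hPA' x hx)
  · simp only [List.length_append, List.length_cons]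
    omega
  · have e : b :: (l₁ ++ (y :: c :: P) ++ l₂.filter (· ∉ A) ++ [b]) =
        (b :: l₁) ++ ([y] ++ ((c :: P) ++ (l₂ ++ [b]).filter (· ∉ A))) := by
      rw [hfb]; simp
    rw [e, List.isChain_append, List.isChain_append, List.isChain_append]
    refine ⟨hch₁, ⟨List.isChain_singleton _, ⟨hPch, ?_, ?_⟩, ?_⟩, ?_⟩
    · exact (List.isChain_cons.mp (hfilter a ha)).2
    · exact fun p hp => (List.isChain_cons.mp
        (hfilter p ((hPA p).mp (List.mem_of_getLast? hp)))).1
    · simpa using hyc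
    · intro q hq z hz
      have : z = y := by simpa using hz.symm
      exact this ▸ hQy q (hqQ q hq)
  · intro x
    rw [Set.mem_insert_iff, hS]
    simp only [List.mem_cons, List.mem_append, List.mem_filter, decide_eq_true_eq]
    rw [← List.mem_cons (a := x) (b := c), hPA x]
    constructor
    · rintro (h | (h | h | h) | ⟨h, -⟩)
      · exact .inr (.inl h)
      · exact .inr (.inr (.inl h))
      · exact .inl h
      · exact .inr ((hS x).mp (hAS h))
      · exact .inr (.inr (.inr (.inr h)))
    · rintro (h | h | h | h | h)
      · exact .inr (.inl (.inr (.inl h)))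
      · exact .inl h
      · exact .inr (.inl (.inl h))
      · exact .inr (.inl (.inr (.inr (h ▸ ha))))
      · by_cases hxA : x ∈ A
        · exact .inr (.inl (.inr (.inr hxA)))
        · exact .inr (.inr ⟨h, hxA⟩)

/-! ### Hamiltonian paths in a union of two cliques -/

lemma exists_list_of_set [Finite V] (S : Set V) : ∃ l : List V, l.Nodup ∧ ∀ x, x ∈ l ↔ x ∈ S := by
  classical
  exact ⟨(Set.toFinite S).toFinset.toList, Finset.nodup_toList _, by simp⟩

lemma isChain_of_clique {l : List V} (hnd : l.Nodup)
    (h : ∀ p ∈ l, ∀ q ∈ l, p ≠ q → G.Adj p q) : List.IsChain G.Adj l :=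
  List.Pairwise.isChain (hnd.imp_of_mem fun hp hq hne => h _ hp _ hq hne)

/-- A connected set that is the union of a nonempty clique `D` and a further clique has a
Hamiltonian path starting in `D`. -/
lemma exists_path_of_two_cliques [Finite V] {A D : Set V} (hA : Conn G A) (hDA : D ⊆ A)
    (hD : D.Nonempty) (hcl : ∀ p ∈ D, ∀ q ∈ D, p ≠ q → G.Adj p q)
    (hcl' : ∀ p ∈ A \ D, ∀ q ∈ A \ D, p ≠ q → G.Adj p q) :
    ∃ c P, c ∈ D ∧ (c :: P).Nodup ∧ (∀ x, x ∈ c :: P ↔ x ∈ A) ∧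
      List.IsChain G.Adj (c :: P) := by
  obtain ⟨d₀, hd₀⟩ := hD
  by_cases hAD : A ⊆ D
  · obtain ⟨l, hnd, hl⟩ := exists_list_of_set A
    match l, hl d₀ with
    | [], h => simp [hDA hd₀] at h
    | c :: P, _ =>
      exact ⟨c, P, hAD ((hl c).mp (by simp)), hnd, hl, isChain_of_clique hnd
        fun p hp q hq => hcl p (hAD ((hl p).mp hp)) q (hAD ((hl q).mp hq))⟩
  obtain ⟨e₀, he₀, he₀D⟩ := Set.not_subset.mp hAD
  obtain ⟨d, hdA, e, heA, hd, he, hde⟩ :=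
    (hA d₀ (hDA hd₀) e₀ he₀).exists_crossing hd₀ (hDA hd₀) he₀D
  obtain ⟨l₁, hnd₁, hl₁⟩ := exists_list_of_set (D \ {d})
  obtain ⟨l₂, hnd₂, hl₂⟩ := exists_list_of_set ((A \ D) \ {e})
  have hnd₁' : (l₁ ++ [d]).Nodup := (List.perm_append_singleton d l₁).nodup_iff.mpr
    (List.nodup_cons.mpr ⟨fun h => ((hl₁ d).mp h).2 rfl, hnd₁⟩)
  have hnd₂' : (e :: l₂).Nodup := List.nodup_cons.mpr ⟨fun h => ((hl₂ e).mp h).2 rfl, hnd₂⟩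
  have hm₁ : ∀ x, x ∈ l₁ ++ [d] ↔ x ∈ D := by
    intro x
    rw [List.mem_append, hl₁, List.mem_singleton, Set.mem_sdiff, Set.mem_singleton_iff]
    by_cases hx : x = d
    · simp [hx, hd]
    · simp [hx]
  have hm₂ : ∀ x, x ∈ e :: l₂ ↔ x ∈ A \ D := by
    intro x
    rw [List.mem_cons, hl₂, Set.mem_sdiff_singleton]
    by_cases hx : x = e
    · simp [hx, he, heA]
    · simp [hx]
  have hnd : (l₁ ++ [d] ++ e :: l₂).Nodup := by
    refine List.nodup_append.mpr ⟨hnd₁', hnd₂', ?_⟩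
    rintro x hx z hz rfl
    exact ((hm₂ x).mp hz).2 ((hm₁ x).mp hx)
  have hmem : ∀ x, x ∈ l₁ ++ [d] ++ e :: l₂ ↔ x ∈ A := by
    intro x
    rw [List.mem_append, hm₁, hm₂]
    by_cases hx : x ∈ D
    · simp [hx, hDA hx]
    · simp [hx]
  have hch : List.IsChain G.Adj (l₁ ++ [d] ++ e :: l₂) := by
    refine List.isChain_append.mpr ⟨isChain_of_clique hnd₁' fun p hp q hq => hcl p ((hm₁ p).mp hp)
      q ((hm₁ q).mp hq), isChain_of_clique hnd₂' fun p hp q hq => hcl' p ((hm₂ p).mp hp)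
      q ((hm₂ q).mp hq), ?_⟩
    intro x hx z hz
    have h1 : x = d := by simpa using hx.symm
    have h2 : z = e := by simpa using hz.symm
    rw [h1, h2]
    exact hde
  match l₁, hm₁, hnd, hmem, hch with
  | [], hm₁, hnd, hmem, hch => exact ⟨d, e :: l₂, hd, hnd, hmem, hch⟩
  | c :: l, hm₁, hnd, hmem, hch =>
    exact ⟨c, l ++ [d] ++ e :: l₂, (hm₁ c).mp (by simp), hnd, hmem, hch⟩

/-! ### Cycles as walks and as lists -/

/-- The vertex set of a cycle carries a cyclic list. -/
lemma hamOn_of_isCycle {v : V} {C : G.Walk v v} (hC : C.IsCycle) : HamOn G (vertexSet C) := by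
  cases C with
  | nil => exact absurd hC SimpleGraph.Walk.not_isCycle_nil
  | @cons _ w _ h p =>
    have hlen := hC.three_le_length
    have hnd := hC.support_nodup
    have hch := (SimpleGraph.Walk.cons h p).isChain_adj_support
    rw [SimpleGraph.Walk.support_cons, List.tail_cons] at hnd
    rw [SimpleGraph.Walk.support_cons] at hch
    rcases List.eq_nil_or_concat p.support with h0 | ⟨l, d, hl⟩
    · simp at h0
    have hd : d = v := by
      have := p.getLast_support
      simp only [hl, List.concat_eq_append, List.getLast_append_singleton] at this
      exact this
    subst hd
    rw [List.concat_eq_append] at hl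
    have hpl := p.length_support
    rw [hl] at hnd hch hpl
    refine ⟨d, l, (List.perm_append_singleton d l).nodup_iff.mp hnd, ?_, hch, ?_⟩
    · simp only [List.length_append, SimpleGraph.Walk.length_cons, List.length_cons,
        List.length_nil] at hlen hpl
      omega
    · intro x
      change _ ↔ x ∈ (SimpleGraph.Walk.cons h p).support
      rw [SimpleGraph.Walk.support_cons, hl]
      simp
      tauto

lemma length_eq_ncard_of_isCycle {v : V} {C : G.Walk v v} (hC : C.IsCycle) :
    C.length = (vertexSet C).ncard := by
  classical
  have h : vertexSet C = (C.support.tail.toFinset : Set V) := by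
    ext x
    rw [List.coe_toFinset]
    change x ∈ C.support ↔ x ∈ C.support.tail
    constructor
    · intro hx
      rw [← SimpleGraph.Walk.cons_tail_support, List.mem_cons] at hx
      rcases hx with rfl | hx
      · exact SimpleGraph.Walk.end_mem_tail_support hC.not_nil
      · exact hx
    · exact List.mem_of_mem_tail
  rw [h, Set.ncard_coe_finset, List.toFinset_card_of_nodup hC.support_nodup, List.length_tail,
    SimpleGraph.Walk.length_support, Nat.add_sub_cancel]

lemma exists_walk_of_isChain {l : List V} {a c : V} (h : List.IsChain G.Adj (c :: (l ++ [a]))) :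
    ∃ p : G.Walk c a, p.support = c :: (l ++ [a]) := by
  induction l generalizing c with
  | nil => exact ⟨.cons (List.isChain_pair.mp h) .nil, rfl⟩
  | cons d l ih =>
    rw [List.cons_append, List.isChain_cons_cons] at h
    obtain ⟨p, hp⟩ := ih h.2
    exact ⟨.cons h.1 p, by rw [SimpleGraph.Walk.support_cons, hp]; rfl⟩

lemma HamOn.exists_isCycle {S : Set V} (h : HamOn G S) :
    ∃ (v : V) (C : G.Walk v v), C.IsCycle ∧ vertexSet C = S := by
  obtain ⟨a, l, hnd, hlen, hch, hmem⟩ := h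
  match l, hlen with
  | c :: d :: l, _ =>
    have hch' : List.IsChain G.Adj (c :: (d :: l ++ [a])) := (List.isChain_cons_cons.mp hch).2
    have hac : G.Adj a c := (List.isChain_cons_cons.mp hch).1
    obtain ⟨p, hp⟩ : ∃ p : G.Walk c a, p.support = c :: (d :: l ++ [a]) := by
      exact exists_walk_of_isChain hch'
    have hpnd : p.support.Nodup := by
      rw [hp]
      exact (List.perm_append_singleton a (c :: d :: l)).nodup_iff.mpr hnd
    refine ⟨a, .cons hac p, ?_, ?_⟩
    · rw [SimpleGraph.Walk.isCycle_iff_isPath_tail_and_le_length]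
      have hl := p.length_support
      rw [hp] at hl
      simp only [List.length_cons, List.length_append, List.length_nil] at hl
      refine ⟨?_, by rw [SimpleGraph.Walk.length_cons]; omega⟩
      refine .mk' ?_
      rw [SimpleGraph.Walk.support_tail_of_not_nil _ SimpleGraph.Walk.not_nil_cons]
      exact hpnd
    · ext x
      rw [← hmem]
      change x ∈ (SimpleGraph.Walk.cons hac p).support ↔ _
      rw [SimpleGraph.Walk.support_cons, hp]
      simp
      tauto

/-! ### Excluding bulls, stars and `K₂ ∨ P₅` -/

/-- In a chordal bull-free graph, a triangle `x, y, z` with neighbours `p` of `x` and `q` of `y`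
that are not adjacent to `z` has `x ~ q` or `y ~ p`: otherwise there is an induced bull, or an
induced 4-cycle if `p ~ q`. -/
lemma adj_or_adj_of_bullFree (hG : Chordal G) (hB : InducedFree bull G) {x y z p q : V}
    (hxy : G.Adj x y) (hxz : G.Adj x z) (hyz : G.Adj y z) (hxp : G.Adj x p) (hyq : G.Adj y q)
    (hzp : ¬ G.Adj z p) (hzq : ¬ G.Adj z q) : G.Adj x q ∨ G.Adj y p := by
  by_contra! h
  obtain ⟨hxq, hyp⟩ := h
  have h1 : p ≠ q := fun e => hyp (e ▸ hyq)
  have h2 : z ≠ p := fun e => hyp (e ▸ hyz)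
  have h3 : z ≠ q := fun e => hxq (e ▸ hxz)
  have h4 : y ≠ p := fun e => hzp (e ▸ hyz.symm)
  have h5 : x ≠ q := fun e => hzq (e ▸ hxz.symm)
  have hpq : ¬ G.Adj p q := fun h =>
    hG.not_square hxp h hyq.symm hxy.symm hxq (fun h => hyp h.symm) h4.symm h5
  refine hB ⟨⟨⟨![x, y, z, p, q], ?_⟩, ?_⟩⟩
  · intro i j
    have := hxy.ne; have := hxz.ne; have := hyz.ne; have := hxp.ne; have := hyq.ne
    fin_cases i <;> fin_cases j <;> simp <;> first | assumption | (apply Ne.symm; assumption)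
  · intro i j
    change G.Adj (![x, y, z, p, q] i) (![x, y, z, p, q] j) ↔ _
    fin_cases i <;> fin_cases j <;>
      simp [bull, hxy, hxz, hyz, hxp, hyq, hzp, hzq, hxq, hyp, hpq, hxy.symm, hxz.symm, hyz.symm,
        hxp.symm, hyq.symm, G.adj_comm p z, G.adj_comm q z, G.adj_comm q x, G.adj_comm p y,
        G.adj_comm q p]

lemma star15_isIndContained {q : V} (f : Fin 5 → V) (hf : Function.Injective f)
    (hq : ∀ i, G.Adj q (f i)) (hind : ∀ i j, ¬ G.Adj (f i) (f j)) :
    star15.IsIndContained G := by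
  refine ⟨⟨⟨Sum.elim (fun _ => q) f, ?_⟩, ?_⟩⟩
  · rintro (i | i) (j | j) h
    · rw [Subsingleton.elim i j]
    · exact absurd h (hq j).ne
    · exact absurd h (hq i).ne'
    · rw [hf h]
  · intro i j
    change G.Adj (Sum.elim (fun _ => q) f i) (Sum.elim (fun _ => q) f j) ↔ _
    rcases i with i | i <;> rcases j with j | j
    · simp [star15]
    · simp [star15, hq]
    · simp [star15, (hq _).symm]
    · simp [star15, hind]

lemma K2joinP5_isIndContained {q q' a b c d e : V} (hqq : G.Adj q q')
    (hq : ∀ x ∈ [a, b, c, d, e], G.Adj q x) (hq' : ∀ x ∈ [a, b, c, d, e], G.Adj q' x)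
    (hab : G.Adj a b) (hbc : G.Adj b c) (hcd : G.Adj c d) (hde : G.Adj d e)
    (hac : ¬ G.Adj a c) (had : ¬ G.Adj a d) (hae : ¬ G.Adj a e) (hbd : ¬ G.Adj b d)
    (hbe : ¬ G.Adj b e) (hce : ¬ G.Adj c e) : K2joinP5.IsIndContained G := by
  obtain ⟨f, hf⟩ : ∃ f : Fin 5 → V, f = ![a, b, c, d, e] := ⟨_, rfl⟩
  obtain ⟨g, hg⟩ : ∃ g : Fin 2 → V, g = ![q, q'] := ⟨_, rfl⟩
  have hfadj : ∀ i j, G.Adj (f i) (f j) ↔ (SimpleGraph.pathGraph 5).Adj i j := by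
    intro i j
    rw [hf, SimpleGraph.pathGraph_adj]
    fin_cases i <;> fin_cases j <;>
      simp [hab, hbc, hcd, hde, hab.symm, hbc.symm, hcd.symm, hde.symm, hac, had, hae, hbd, hbe,
        hce, G.adj_comm c a, G.adj_comm d a, G.adj_comm e a, G.adj_comm d b, G.adj_comm e b,
        G.adj_comm e c]
  have hfinj : Function.Injective f := by
    -- vertices of a path on five vertices are determined by their neighbourhoods
    intro i j hij
    have h : ∀ k, (SimpleGraph.pathGraph 5).Adj i k ↔ (SimpleGraph.pathGraph 5).Adj j k := by
      intro k
      rw [← hfadj, ← hfadj, hij]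
    simp only [SimpleGraph.pathGraph_adj] at h
    clear hij
    revert i j
    decide
  have hgf : ∀ i j, G.Adj (g i) (f j) := by
    intro i j
    rw [hf, hg]
    fin_cases i <;> fin_cases j <;> first | exact hq _ (by simp) | exact hq' _ (by simp)
  have hgadj : ∀ i j, G.Adj (g i) (g j) ↔ i ≠ j := by
    intro i j
    rw [hg]
    fin_cases i <;> fin_cases j <;> simp [hqq, hqq.symm]
  refine ⟨⟨⟨Sum.elim g f, ?_⟩, ?_⟩⟩
  · rintro (i | i) (j | j) h
    · by_contra hne
      have := (hgadj i j).mpr (fun e => hne (congrArg _ e))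
      exact this.ne h
    · exact absurd h (hgf i j).ne
    · exact absurd h (hgf j i).ne'
    · rw [hfinj h]
  · intro i j
    change G.Adj (Sum.elim g f i) (Sum.elim g f j) ↔ _
    rcases i with i | i <;> rcases j with j | j
    · simp [K2joinP5, join, hgadj]
    · simp [K2joinP5, join, hgf]
    · simp [K2joinP5, join, (hgf _ _).symm]
    · simp [K2joinP5, join, hfadj]

/-- If `y` has neighbours and non-neighbours in the connected set `E`, and a further neighbour `α`
without neighbours in `E`, then `N(y) ∩ E` is a clique with a common neighbour in `E \ N(y)`. -/
lemma attachment_clique (hG : Chordal G) (hB : InducedFree bull G) {E : Set V} {y α : V}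
    (hE : Conn G E) (hy : y ∉ E) (hα : G.Adj y α) (hαE : ∀ x ∈ E, ¬ G.Adj x α)
    {d₀ s₀ : V} (hd₀ : d₀ ∈ E) (hyd₀ : G.Adj y d₀) (hs₀ : s₀ ∈ E) (hys₀ : ¬ G.Adj y s₀) :
    (∃ s ∈ E, ¬ G.Adj y s ∧ ∀ d ∈ E, G.Adj y d → G.Adj d s) ∧
      ∀ d ∈ E, ∀ d' ∈ E, G.Adj y d → G.Adj y d' → d ≠ d' → G.Adj d d' := by
  obtain ⟨t, htE, s, hsE, hyt, hys, hts⟩ :=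
    (hE d₀ hd₀ s₀ hs₀).exists_crossing (S := {x | G.Adj y x}) hyd₀ hd₀ hys₀
  have hs : ∀ d ∈ E, G.Adj y d → G.Adj d s := by
    intro d hd hyd
    refine Joined.induction_mem (P := fun d => (d ∈ E ∧ G.Adj y d) ∧ G.Adj d s)
      (hG.conn_inter_neighborSet hE hy t ⟨htE, hyt⟩ d ⟨hd, hyd⟩) ⟨⟨htE, hyt⟩, hts⟩ ?_ |>.2
    rintro u v ⟨hv, hyv⟩ ⟨⟨hu, hyu⟩, hus⟩ huv
    refine ⟨⟨hv, hyv⟩, ?_⟩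
    by_contra hvs
    rcases adj_or_adj_of_bullFree hG hB hyu.symm huv hyv hus hα hvs (hαE v hv) with h | h
    · exact hαE u hu h
    · exact hys h
  refine ⟨⟨s, hsE, hys, hs⟩, fun d hd d' hd' hyd hyd' hne => ?_⟩
  by_contra h
  exact hG.not_square (hs d hd hyd) (hs d' hd' hyd').symm hyd'.symm hyd h (fun h => hys h.symm)
    (fun e => hy (e ▸ hsE)) hne

/-- If moreover `q ~ y` has a neighbour in `N(y) ∩ E` and a neighbour `σ` adjacent neither to `y`
nor to `E`, then `q` is complete to `E`. -/
lemma complete_of_attachment (hG : Chordal G) (hB : InducedFree bull G) {E : Set V} {y q σ : V}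
    (hE : Conn G E) (hy : y ∉ E) (hqy : G.Adj q y) (hqσ : G.Adj q σ) (hyσ : ¬ G.Adj y σ)
    (hσE : ∀ x ∈ E, ¬ G.Adj x σ) {e₀ s : V} (he₀ : e₀ ∈ E) (hye₀ : G.Adj y e₀)
    (hqe₀ : G.Adj q e₀) (hs : s ∈ E) (hys : ¬ G.Adj y s)
    (hsD : ∀ d ∈ E, G.Adj y d → G.Adj d s) : ∀ x ∈ E, G.Adj q x := by
  -- along an edge `z w` inside `N(q)`, neighbours of `w` outside `N(z)` lie in `N(q)`
  have step : ∀ z w r, G.Adj q z → G.Adj q w → w ∈ E → G.Adj w z → ¬ G.Adj z σ → G.Adj w r →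
      ¬ G.Adj z r → G.Adj q r := by
    intro z w r hqz hqw hw hwz hzσ hwr hzr
    exact (adj_or_adj_of_bullFree hG hB hqw.symm hwz hqz hwr hqσ hzr hzσ).resolve_left (hσE w hw)
  have hqs : G.Adj q s := step y e₀ s hqy hqe₀ he₀ hye₀.symm hyσ (hsD e₀ he₀ hye₀) hys
  have hqD : ∀ d ∈ E, G.Adj y d → G.Adj q d := by
    intro d hd hyd
    by_contra h
    refine hG.not_square (hsD d hd hyd) hqs.symm hqy hyd (fun h' => h h'.symm)
      (fun h => hys h.symm) (fun e => hy (e ▸ hs)) ?_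
    rintro rfl
    exact hσE d hd hqσ
  intro x hx
  refine (Joined.induction_mem
    (P := fun v => v ∈ E ∧ G.Adj q v ∧ ∀ r ∈ E, G.Adj v r → G.Adj q r) (hE e₀ he₀ x hx)
    ⟨he₀, hqe₀, fun r hr her => ?_⟩ ?_).2.1
  · by_cases hyr : G.Adj y r
    · exact hqD r hr hyr
    · exact step y e₀ r hqy hqe₀ he₀ hye₀.symm hyσ her hyr
  · rintro v w hw ⟨hv, hqv, hvr⟩ hvw
    have hqw := hvr w hw hvw
    refine ⟨hw, hqw, fun r hr hwr => ?_⟩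
    by_cases hr' : G.Adj v r
    · exact hvr r hr hr'
    · exact step v w r hqv hqw hw hvw.symm (hσE v hv) hwr hr'

/-! ### Bridges over a separation of the cycle -/

lemma Conn.union {A B : Set V} (hA : Conn G A) (hB : Conn G B) {x y : V} (hx : x ∈ A) (hy : y ∈ B)
    (hxy : G.Adj x y) : Conn G (A ∪ B) := by
  have h1 : ∀ u ∈ A, Joined G (A ∪ B) u x :=
    fun u hu => (hA u hu x hx).mono Set.subset_union_left
  have h2 : ∀ u ∈ B, Joined G (A ∪ B) u x := fun u hu =>
    ((hB u hu y hy).mono Set.subset_union_right).trans (Joined.single hxy.symm (.inl hx))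
  have h3 : ∀ u ∈ A ∪ B, Joined G (A ∪ B) u x := fun u hu => hu.elim (h1 u) (h2 u)
  exact fun u hu v hv => (h3 u hu).trans ((h3 v hv).symm hv)

lemma conn_singleton (y : V) : Conn G {y} := by
  rintro u rfl v rfl
  exact .refl

/-- A bridge over a separation `A, B, Q` of `G[S]`: a vertex `y` outside `S` adjacent to `A` and
to a connected set `E ⊇ B` that has no edge to `A` and meets `S` only in `B`. -/
structure Bridge (G : SimpleGraph V) (S A B E : Set V) (y : V) : Prop where
  right_sub : B ⊆ E
  conn : Conn G E
  inter : ∀ x ∈ E, x ∈ S → x ∈ B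
  not_mem : y ∉ S
  anti : ∀ x ∈ A, ∀ z ∈ E, ¬ G.Adj x z
  nbr_left : ∃ x ∈ A, G.Adj y x
  nbr_right : ∃ x ∈ E, G.Adj y x

/-- `E` consists of the vertices reachable from `b` through `B` and through vertices outside `S`
without neighbours in `A`; on the way from `b` to `a` through `K`, the first vertex outside `E` is
the required `y`. -/
lemma Separation.exists_bridge {S A B Q K : Set V} {a b ka kb : V} (h : Separation G S A B Q a b)
    (hK : Conn G K) (hKS : ∀ x ∈ K, x ∉ S) (hka : ka ∈ K) (hkb : kb ∈ K) (haka : G.Adj a ka)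
    (hbkb : G.Adj b kb) : ∃ E y, Bridge G S A B E y := by
  let X : Set V := {x | x ∈ B ∨ (x ∉ S ∧ ∀ a ∈ A, ¬ G.Adj a x)}
  let E : Set V := {x | Joined G X b x}
  have hEX : ∀ x ∈ E, x ∈ X := fun x hx => Joined.mem (.inl h.mem_right) hx
  have hanti : ∀ x ∈ A, ∀ z ∈ E, ¬ G.Adj x z := fun x hx z hz =>
    (hEX z hz).elim (fun hzB => h.anti x hx z hzB) (fun hz => hz.2 x hx)
  obtain ⟨y, hyS, hy₁, hy₂⟩ : ∃ y ∉ S, (∃ x ∈ A, G.Adj y x) ∧ ∃ x ∈ E, G.Adj y x := by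
    by_contra! hno
    have step : ∀ e ∈ E, ∀ k ∈ K, G.Adj e k → k ∈ E := by
      intro e he k hk hek
      refine Relation.ReflTransGen.tail he ⟨hek, .inr ⟨hKS k hk, fun x hx hxk => ?_⟩⟩
      exact hno k (hKS k hk) ⟨x, hx, hxk.symm⟩ e he hek.symm
    have hkaE : ka ∈ E := Joined.induction_mem (P := fun x => x ∈ E) (hK kb hkb ka hka)
      (step b .refl kb hkb hbkb) fun e k hk he hek => step e he k hk hek
    exact hanti a h.mem_left ka hkaE haka
  exact ⟨E, y, fun x hx => (h.conn_right b h.mem_right x hx).mono fun _ => .inl,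
    conn_setOf_joined, fun x hx hxS => (hEX x hx).resolve_right fun h => h.1 hxS, hyS, hanti,
    hy₁, hy₂⟩

section Bridge

variable {S A B Q E : Set V} {a b y : V}

/-- Every vertex of the separator is adjacent to `y` and to a neighbour of `y` on both sides. -/
lemma Bridge.sep_adj (hG : Chordal G) (h : Separation G S A B Q a b) (hbr : Bridge G S A B E y)
    {q : V} (hq : q ∈ Q) :
    G.Adj q y ∧ (∃ x ∈ A, G.Adj q x ∧ G.Adj y x) ∧ ∃ x ∈ E, G.Adj q x ∧ G.Adj y x := by
  obtain ⟨x₁, hx₁, hyx₁⟩ := hbr.nbr_left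
  obtain ⟨x₂, hx₂, hyx₂⟩ := hbr.nbr_right
  obtain ⟨a', ha', hqa'⟩ := h.nbr_left q hq
  obtain ⟨b', hb', hqb'⟩ := h.nbr_right q hq
  have hqS := h.sep_sub hq
  have hX : Conn G ((A ∪ {y}) ∪ E) :=
    (h.conn_left.union (conn_singleton y) hx₁ rfl hyx₁.symm).union hbr.conn (.inr rfl) hx₂ hyx₂
  have hqX : q ∉ (A ∪ {y}) ∪ E := by
    rintro ((hqA | rfl) | hqE)
    · exact h.left_sep q hqA hq
    · exact hbr.not_mem hqS
    · exact h.right_sep q (hbr.inter q hqE hqS) hq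
  have hb'E := hbr.right_sub hb'
  have hyE : y ∉ E := fun hy => hbr.anti x₁ hx₁ y hy hyx₁.symm
  have hAE : ∀ x ∈ A, x ∉ E := fun x hx hxE => h.disj x hx (hbr.inter x hxE (h.left_sub hx))
  have hJ := hG.conn_inter_neighborSet hX hqX a' ⟨.inl (.inl ha'), hqa'⟩ b' ⟨.inr hb'E, hqb'⟩
  have hb'A : b' ∉ A ∪ {y} := by
    rintro (hA | rfl)
    · exact hAE b' hA hb'E
    · exact hyE hb'E
  obtain ⟨u, ⟨-, hqu⟩, v, ⟨hv, hqv⟩, huA, hvA, huv⟩ :=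
    hJ.exists_crossing ha' ⟨.inl (.inl ha'), hqa'⟩ fun h => hAE b' h hb'E
  obtain ⟨u', ⟨-, hqu'⟩, v', ⟨hv', hqv'⟩, hu'A, hv'A, huv'⟩ :=
    hJ.exists_crossing (.inl ha') ⟨.inl (.inl ha'), hqa'⟩ hb'A
  have hvy : v = y := by
    rcases hv with (hv | hv) | hv
    · exact absurd hv hvA
    · exact hv
    · exact absurd huv (hbr.anti u huA v hv)
  subst hvy
  have hv'E : v' ∈ E := hv'.resolve_left hv'A
  have hu'y : u' = v := hu'A.resolve_left fun hu' => hbr.anti u' hu' v' hv'E huv'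
  subst hu'y
  exact ⟨hqv, ⟨u, huA, hqu, huv.symm⟩, v', hv'E, hqv', huv'⟩

/-- If no vertex can be inserted into the cycle on `S`, the separator is complete to both sides of
the bridge, and the neighbourhoods of `y` on both sides are cliques. -/
lemma Bridge.complete (hG : Chordal G) (hB : InducedFree bull G) (hS : HamOn G S)
    (hext : ∀ y ∉ S, ¬ HamOn G (insert y S)) (h : Separation G S A B Q a b)
    (hbr : Bridge G S A B E y) :
    (∀ q ∈ Q, ∀ x ∈ A ∪ E, G.Adj q x) ∧
    (∃ d s, d ∈ A ∧ s ∈ A ∧ G.Adj y d ∧ ¬ G.Adj y s ∧ G.Adj d s) ∧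
    (∃ d s, d ∈ E ∧ s ∈ E ∧ G.Adj y d ∧ ¬ G.Adj y s ∧ G.Adj d s) ∧
    (∀ d ∈ A, ∀ d' ∈ A, G.Adj y d → G.Adj y d' → d ≠ d' → G.Adj d d') ∧
    (∀ d ∈ E, ∀ d' ∈ E, G.Adj y d → G.Adj y d' → d ≠ d' → G.Adj d d') := by
  have hQ := fun q (hq : q ∈ Q) => hbr.sep_adj hG h hq
  obtain ⟨α, hαA, hyα⟩ := hbr.nbr_left
  obtain ⟨β, hβE, hyβ⟩ := hbr.nbr_right
  have hyA : y ∉ A := fun hy => hbr.not_mem (h.left_sub hy)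
  have hyE : y ∉ E := fun hy => hbr.anti α hαA y hy hyα.symm
  have hnext : ∀ v ∈ S, ∃ c ∈ S, G.Adj v c ∧ (G.Adj y v → ¬ G.Adj y c) := by
    intro v hv
    obtain ⟨c, hc, hvc, hins⟩ := hS.exists_next hv
    exact ⟨c, hc, hvc, fun hyv hyc => hext y hbr.not_mem (hins y hbr.not_mem hyv hyc)⟩
  -- successors of neighbours of `y` avoid `Q`, as `y` is complete to `Q`
  have hcA : ∀ v ∈ A, ∀ c ∈ S, G.Adj v c → ¬ G.Adj y c → c ∈ A := fun v hv c hc hvc hyc =>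
    (h.left_nbr v hv c hc hvc).resolve_right fun hcQ => hyc (hQ c hcQ).1.symm
  have hA₀ : ∃ s ∈ A, ¬ G.Adj y s := by
    obtain ⟨c, hc, hαc, hyc⟩ := hnext α (h.left_sub hαA)
    exact ⟨c, hcA α hαA c hc hαc (hyc hyα), hyc hyα⟩
  have hE₀ : ∃ s ∈ E, ¬ G.Adj y s := by
    by_cases hyb : G.Adj y b
    · obtain ⟨c, hc, hbc, hyc⟩ := hnext b (h.right_sub h.mem_right)
      exact ⟨c, hbr.right_sub ((h.right_nbr b h.mem_right c hc hbc).resolve_right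
        fun hcQ => hyc hyb (hQ c hcQ).1.symm), hyc hyb⟩
    · exact ⟨b, hbr.right_sub h.mem_right, hyb⟩
  obtain ⟨sA₀, hsA₀, hysA₀⟩ := hA₀
  obtain ⟨sE₀, hsE₀, hysE₀⟩ := hE₀
  obtain ⟨⟨sA, hsA, hysA, hsAD⟩, hclA⟩ := attachment_clique hG hB h.conn_left hyA hyβ
    (fun x hx => hbr.anti x hx β hβE) hαA hyα hsA₀ hysA₀
  obtain ⟨⟨sE, hsE, hysE, hsED⟩, hclE⟩ := attachment_clique hG hB hbr.conn hyE hyα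
    (fun x hx h' => hbr.anti α hαA x hx h'.symm) hβE hyβ hsE₀ hysE₀
  have hQE : ∀ q ∈ Q, ∀ x ∈ E, G.Adj q x := by
    intro q hq
    obtain ⟨hqy, ⟨a', ha', hqa', hya'⟩, e', he', hqe', hye'⟩ := hQ q hq
    -- a neighbour of `q` in `A \ N(y)`: the successor of `a'` or of `q` on the cycle
    obtain ⟨σ, hσ, hqσ, hyσ⟩ : ∃ σ ∈ A, G.Adj q σ ∧ ¬ G.Adj y σ := by
      obtain ⟨c, hc, hac, hyc⟩ := hnext a' (h.left_sub ha')
      obtain ⟨c', hc', hqc', hyc'⟩ := hnext q (h.sep_sub hq)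
      have hyc := hyc hya'
      have hyc' := hyc' hqy.symm
      rcases adj_or_adj_of_bullFree hG hB hqa'.symm hya'.symm hqy hac hqc' hyc hyc' with h1 | h1
      · exact ⟨c', hcA a' ha' c' hc' h1 hyc', hqc', hyc'⟩
      · exact ⟨c, hcA a' ha' c hc hac hyc, h1, hyc⟩
    exact complete_of_attachment hG hB hbr.conn hyE hqy hqσ hyσ
      (fun x hx h' => hbr.anti σ hσ x hx h'.symm) he' hye' hqe' hsE hysE hsED
  have hQA : ∀ q ∈ Q, ∀ x ∈ A, G.Adj q x := by
    intro q hq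
    obtain ⟨hqy, ⟨a', ha', hqa', hya'⟩, -⟩ := hQ q hq
    exact complete_of_attachment hG hB h.conn_left hyA hqy (hQE q hq sE hsE) hysE
      (fun x hx => hbr.anti x hx sE hsE) ha' hya' hqa' hsA hysA hsAD
  exact ⟨fun q hq x hx => hx.elim (hQA q hq x) (hQE q hq x),
    ⟨α, sA, hαA, hsA, hyα, hysA, hsAD α hαA hyα⟩, ⟨β, sE, hβE, hsE, hyβ, hysE, hsED β hβE hyβ⟩,
    hclA, hclE⟩

/-- `A \ N(y)` is not a clique: otherwise `G[A]` has a Hamiltonian path starting next to `y`, and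
the cycle can be rerouted through `y`. -/
lemma Bridge.exists_nonadj_left [Finite V] (hS : HamOn G S)
    (hext : ∀ y ∉ S, ¬ HamOn G (insert y S)) (h : Separation G S A B Q a b)
    (hbr : Bridge G S A B E y) (hQy : ∀ q ∈ Q, G.Adj q y)
    (hQc : ∀ q ∈ Q, ∀ x ∈ A ∪ E, G.Adj q x)
    (hcl : ∀ d ∈ A, ∀ d' ∈ A, G.Adj y d → G.Adj y d' → d ≠ d' → G.Adj d d') :
    ∃ l ∈ A, ∃ l' ∈ A, l ≠ l' ∧ ¬ G.Adj l l' ∧ ¬ G.Adj y l ∧ ¬ G.Adj y l' := by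
  by_contra! hno
  obtain ⟨α, hαA, hyα⟩ := hbr.nbr_left
  obtain ⟨c, P, ⟨-, hyc⟩, hnd, hmem, hch⟩ := exists_path_of_two_cliques (D := {x ∈ A | G.Adj y x})
    h.conn_left (fun x hx => hx.1) ⟨α, hαA, hyα⟩
    (fun p hp q hq hpq => hcl p hp.1 q hq.1 hp.2 hq.2 hpq) (fun p hp q hq hpq => by
      by_contra hadj
      exact hq.2 ⟨hq.1, hno p hp.1 q hq.1 hpq hadj fun hyp => hp.2 ⟨hp.1, hyp⟩⟩)
  exact hext y hbr.not_mem (hS.insert_of_path h.left_sub h.left_nbr h.clique ⟨a, h.mem_left⟩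
    (h.right_sub h.mem_right) (fun hbA => h.disj b hbA h.mem_right) hbr.not_mem hQy
    (fun q hq x hx => hQc q hq x (.inl hx)) hnd hmem hch hyc)

/-- `E \ N(y)` is not a clique: otherwise the cycle can be rerouted within `B`. If `y` has no
neighbour in `B`, then `B` itself is a clique, with a neighbour in `E \ B` that takes over the role
of `y`. -/
lemma Bridge.exists_nonadj_right [Finite V] (hS : HamOn G S)
    (hext : ∀ y ∉ S, ¬ HamOn G (insert y S)) (h : Separation G S A B Q a b)
    (hbr : Bridge G S A B E y) (hQy : ∀ q ∈ Q, G.Adj q y)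
    (hQc : ∀ q ∈ Q, ∀ x ∈ A ∪ E, G.Adj q x)
    (hcl : ∀ d ∈ E, ∀ d' ∈ E, G.Adj y d → G.Adj y d' → d ≠ d' → G.Adj d d') :
    ∃ l ∈ E, ∃ l' ∈ E, l ≠ l' ∧ ¬ G.Adj l l' ∧ ¬ G.Adj y l ∧ ¬ G.Adj y l' := by
  by_contra! hno
  obtain ⟨e, heS, x₀, hx₀, hex₀, hQe, hclD, hclL⟩ : ∃ e ∉ S, ∃ x₀ ∈ B, G.Adj e x₀ ∧
      (∀ q ∈ Q, G.Adj q e) ∧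
      (∀ p ∈ B, ∀ q ∈ B, G.Adj e p → G.Adj e q → p ≠ q → G.Adj p q) ∧
      (∀ p ∈ B, ∀ q ∈ B, ¬ G.Adj e p → ¬ G.Adj e q → p ≠ q → G.Adj p q) := by
    by_cases hyB : ∃ x ∈ B, G.Adj y x
    · obtain ⟨x₀, hx₀, hyx₀⟩ := hyB
      refine ⟨y, hbr.not_mem, x₀, hx₀, hyx₀, hQy, fun p hp q hq =>
        hcl p (hbr.right_sub hp) q (hbr.right_sub hq), fun p hp q hq hyp hyq hpq => ?_⟩
      by_contra hadj
      exact hyq (hno p (hbr.right_sub hp) q (hbr.right_sub hq) hpq hadj hyp)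
    · push Not at hyB
      obtain ⟨β, hβE, hyβ⟩ := hbr.nbr_right
      obtain ⟨x₀, -, e, heE, hx₀, heB, hxe⟩ := (hbr.conn b (hbr.right_sub h.mem_right) β
        hβE).exists_crossing h.mem_right (hbr.right_sub h.mem_right) fun hβ => hyB β hβ hyβ
      have hBcl : ∀ p ∈ B, ∀ q ∈ B, p ≠ q → G.Adj p q := by
        intro p hp q hq hpq
        by_contra hadj
        exact hyB q hq (hno p (hbr.right_sub hp) q (hbr.right_sub hq) hpq hadj (hyB p hp))
      exact ⟨e, fun heS => heB (hbr.inter e heE heS), x₀, hx₀, hxe.symm,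
        fun q hq => hQc q hq e (.inr heE), fun p hp q hq _ _ => hBcl p hp q hq,
        fun p hp q hq _ _ => hBcl p hp q hq⟩
  obtain ⟨c, P, ⟨-, hec⟩, hnd, hmem, hch⟩ := exists_path_of_two_cliques (D := {x ∈ B | G.Adj e x})
    h.conn_right (fun x hx => hx.1) ⟨x₀, hx₀, hex₀⟩
    (fun p hp q hq hpq => hclD p hp.1 q hq.1 hp.2 hq.2 hpq)
    (fun p hp q hq hpq => hclL p hp.1 q hq.1 (fun h => hp.2 ⟨hp.1, h⟩) (fun h => hq.2 ⟨hq.1, h⟩)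
      hpq)
  exact hext e heS (hS.insert_of_path h.right_sub h.right_nbr h.clique ⟨b, h.mem_right⟩
    (h.left_sub h.mem_left) (h.disj a h.mem_left) heS hQe
    (fun q hq x hx => hQc q hq x (.inr (hbr.right_sub hx))) hnd hmem hch hec)

end Bridge

/-- The core of the argument: if two nonadjacent vertices of a cycle are linked through vertices
outside the cycle, then some outside vertex can be added to the cycle. -/
lemma HamOn.exists_insert [Finite V] (hG : Chordal G) (hB : InducedFree bull G)
    (hfree : InducedFree star15 G ∨ InducedFree K2joinP5 G) {S K : Set V} (hS : HamOn G S)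
    (hK : Conn G K) (hKS : ∀ x ∈ K, x ∉ S) {a b ka kb : V} (ha : a ∈ S) (hb : b ∈ S)
    (hne : a ≠ b) (hab : ¬ G.Adj a b) (hka : ka ∈ K) (hkb : kb ∈ K) (haka : G.Adj a ka)
    (hbkb : G.Adj b kb) : ∃ y ∉ S, HamOn G (insert y S) := by
  by_contra! hext
  obtain ⟨A, B, Q, h⟩ := hG.exists_separation ha hb hab hne
  obtain ⟨E, y, hbr⟩ := h.exists_bridge hK hKS hka hkb haka hbkb
  obtain ⟨q, hq, q', hq', hqq'⟩ := hS.exists_pair h.mem_left ha hb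
    (fun hbA => h.disj b hbA h.mem_right) (h.right_sep b h.mem_right) (h.left_sep a h.mem_left)
    h.left_nbr
  obtain ⟨hQc, ⟨d, s, hd, hs, hyd, hys, hds⟩, ⟨d', s', hd', hs', hyd', hys', hds'⟩, hclA, hclE⟩ :=
    hbr.complete hG hB hS hext h
  have hQy := fun q (hq : q ∈ Q) => (hbr.sep_adj hG h hq).1
  rcases hfree with hfree | hfree
  · -- `q` is the centre of an induced star with leaves `y`, `l`, `l'`, `m`, `m'`
    obtain ⟨l, hl, l', hl', hll, hll', hyl, hyl'⟩ :=
      hbr.exists_nonadj_left hS hext h hQy hQc hclA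
    obtain ⟨m, hm, m', hm', hmm, hmm', hym, hym'⟩ :=
      hbr.exists_nonadj_right hS hext h hQy hQc hclE
    have hAE : ∀ x ∈ A, ∀ z ∈ E, x ≠ z ∧ ¬ G.Adj x z := fun x hx z hz =>
      ⟨fun e => h.disj x hx (hbr.inter x (e ▸ hz) (h.left_sub hx)), hbr.anti x hx z hz⟩
    have hyA : ∀ x ∈ A, y ≠ x := fun x hx e => hbr.not_mem (e ▸ h.left_sub hx)
    have hyE : ∀ x ∈ E, y ≠ x := fun x hx e => hbr.anti d hd x hx (e ▸ hyd.symm)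
    refine hfree (star15_isIndContained (q := q) ![y, l, l', m, m'] ?_ ?_ ?_)
    · intro i j
      have := hyA l hl; have := hyA l' hl'; have := hyE m hm; have := hyE m' hm'
      have := (hAE l hl m hm).1; have := (hAE l hl m' hm').1
      have := (hAE l' hl' m hm).1; have := (hAE l' hl' m' hm').1
      fin_cases i <;> fin_cases j <;> simp <;> first | assumption | (apply Ne.symm; assumption)
    · intro i
      fin_cases i
      · exact hQy q hq
      · exact hQc q hq l (.inl hl)
      · exact hQc q hq l' (.inl hl')
      · exact hQc q hq m (.inr hm)
      · exact hQc q hq m' (.inr hm')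
    · have := (hAE l hl m hm).2; have := (hAE l hl m' hm').2
      have := (hAE l' hl' m hm).2; have := (hAE l' hl' m' hm').2
      intro i j
      fin_cases i <;> fin_cases j <;> first
        | exact G.loopless.irrefl _
        | assumption
        | (intro h; exact absurd h.symm (by assumption))
  · -- `s d y d' s'` is an induced path in the common neighbourhood of `q` and `q'`
    have key : ∀ q ∈ Q, ∀ x ∈ [s, d, y, d', s'], G.Adj q x := by
      intro q hq x hx
      simp only [List.mem_cons, List.not_mem_nil, or_false] at hx
      rcases hx with rfl | rfl | rfl | rfl | rfl
      · exact hQc q hq _ (.inl hs)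
      · exact hQc q hq _ (.inl hd)
      · exact hQy q hq
      · exact hQc q hq _ (.inr hd')
      · exact hQc q hq _ (.inr hs')
    exact hfree (K2joinP5_isIndContained (h.clique q hq q' hq' hqq') (key q hq) (key q' hq')
      hds.symm hyd.symm hyd' hds' (fun h => hys h.symm) (hbr.anti s hs d' hd')
      (hbr.anti s hs s' hs') (hbr.anti d hd d' hd') (hbr.anti d hd s' hs') hys')

/-! ### Extending cycles -/

/-- Reduction to `HamOn.exists_insert`: take a smallest `U ⊋ S` carrying a cycle. A component of
`G[U \ S]` whose boundary is a clique contains a vertex simplicial in `G[U]`; deleting it leaves a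
cycle, so by minimality it is the only vertex of `U \ S`. -/
lemma HamOn.exists_insert_of_hamiltonian [Finite V] (hG : Chordal G) (hB : InducedFree bull G)
    (hfree : InducedFree star15 G ∨ InducedFree K2joinP5 G) (hham : HamOn G (Set.univ : Set V))
    {S : Set V} (hS : HamOn G S) (hcard : 3 ≤ S.ncard) (hne : S ≠ Set.univ) :
    ∃ y ∉ S, HamOn G (insert y S) := by
  obtain ⟨U, ⟨hSU, hU⟩, hmin⟩ := exists_minimal_of_wellFoundedLT
    (fun U : Set V => S ⊂ U ∧ HamOn G U) ⟨Set.univ, Set.ssubset_univ_iff.mpr hne, hham⟩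
  obtain ⟨u₀, hu₀U, hu₀S⟩ := Set.exists_of_ssubset hSU
  let K : Set V := {x | Joined G (U \ S) u₀ x}
  have hKU : ∀ x ∈ K, x ∈ U \ S := fun x hx => Joined.mem ⟨hu₀U, hu₀S⟩ hx
  have hnbr : ∀ p ∈ U \ K, (∃ x ∈ K, G.Adj x p) → p ∈ S := by
    rintro p hp ⟨x, hx, hxp⟩
    by_contra hpS
    exact hp.2 (Relation.ReflTransGen.tail hx ⟨hxp, hp.1, hpS⟩)
  by_cases hcl : ∀ p ∈ U \ K, ∀ q ∈ U \ K, (∃ x ∈ K, G.Adj x p) → (∃ x ∈ K, G.Adj x q) → p ≠ q →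
      G.Adj p q
  · obtain ⟨s, hsK, hsimp⟩ := hG.exists_simplicial (fun x hx => (hKU x hx).1) ⟨u₀, .refl⟩ hcl
    obtain ⟨hsU, hsS⟩ := hKU s hsK
    have hlt := Set.ncard_lt_ncard hSU
    have hdel : HamOn G (U \ {s}) := hU.diff_simplicial hsU (by omega) hsimp
    have hsub : S ⊆ U \ {s} := fun x hx => ⟨hSU.1 hx, fun e => hsS (e ▸ hx)⟩
    have hSeq : S = U \ {s} := by
      by_contra hne'
      exact (hmin ⟨hsub.ssubset_of_ne hne', hdel⟩ Set.sdiff_subset hsU).2 rfl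
    refine ⟨s, hsS, ?_⟩
    rw [hSeq, Set.insert_sdiff_singleton, Set.insert_eq_of_mem hsU]
    exact hU
  · push Not at hcl
    obtain ⟨p, hp, q, hq, ⟨x, hx, hxp⟩, ⟨z, hz, hzq⟩, hpq, hadj⟩ := hcl
    exact hS.exists_insert hG hB hfree (K := K) conn_setOf_joined (fun x hx => (hKU x hx).2)
      (hnbr p hp ⟨x, hx, hxp⟩) (hnbr q hq ⟨z, hz, hzq⟩) hpq hadj hx hz hxp.symm hzq.symm

/-- The two neighbours of `v` on a Hamiltonian cycle are connected in `G - v`, hence within the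
neighbourhood of `v`. -/
lemma HamOn.exists_triangle (hG : Chordal G) (hham : HamOn G (Set.univ : Set V)) (v : V) :
    ∃ a b, G.Adj v a ∧ G.Adj v b ∧ G.Adj a b := by
  obtain ⟨c, d, -, hcd, hvc, hvd, -⟩ := hham.exists_two (Set.mem_univ v)
  have hX := hG.conn_inter_neighborSet (hham.conn_diff v) (z := v) (fun h => h.2 rfl)
  have hc : c ∈ (Set.univ \ {v}) ∩ G.neighborSet v := ⟨⟨trivial, hvc.ne'⟩, hvc⟩
  have hd : d ∈ (Set.univ \ {v}) ∩ G.neighborSet v := ⟨⟨trivial, hvd.ne'⟩, hvd⟩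
  obtain ⟨x, hx, y, hy, -, -, hxy⟩ := (hX c hc d hd).exists_crossing (S := {c}) rfl hc hcd.symm
  exact ⟨x, y, hx.2, hy.2, hxy⟩

end HamChordal

theorem theorem6 {V : Type*} [Finite V] [DecidableEq V] (G : SimpleGraph V)
    (hham : HamChordal.Hamiltonian G) (hchord : HamChordal.Chordal G)
    (hfree : (HamChordal.InducedFree HamChordal.bull G ∧
          HamChordal.InducedFree HamChordal.star15 G) ∨
        (HamChordal.InducedFree HamChordal.bull G ∧
          HamChordal.InducedFree HamChordal.K2joinP5 G)) :
    HamChordal.FullyCycleExtendable G := by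
  have hB : HamChordal.InducedFree HamChordal.bull G := hfree.elim (·.1) (·.1)
  have hfree' := hfree.imp And.right And.right
  have huniv : HamChordal.HamOn G (Set.univ : Set V) := by
    obtain ⟨v, C, hC⟩ := hham
    have h := HamChordal.hamOn_of_isCycle hC.isCycle
    rwa [show HamChordal.vertexSet C = Set.univ from Set.eq_univ_of_forall hC.mem_support] at h
  refine ⟨fun v C hC hnot => ?_, fun v => huniv.exists_triangle hchord v⟩
  have hlen := HamChordal.length_eq_ncard_of_isCycle hC
  have hne : HamChordal.vertexSet C ≠ Set.univ := by
    intro h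
    apply hnot
    rw [SimpleGraph.Walk.isHamiltonianCycle_iff_isCycle_and_support_count_tail_eq_one]
    refine ⟨hC, fun a => List.count_eq_one_of_mem hC.support_nodup ?_⟩
    have ha : a ∈ C.support := h.symm.subset (Set.mem_univ a)
    rw [← SimpleGraph.Walk.cons_tail_support, List.mem_cons] at ha
    rcases ha with rfl | ha
    · exact SimpleGraph.Walk.end_mem_tail_support hC.not_nil
    · exact ha
  obtain ⟨y, hy, hins⟩ := HamChordal.HamOn.exists_insert_of_hamiltonian hchord hB
    hfree' huniv (HamChordal.hamOn_of_isCycle hC) (hlen ▸ hC.three_le_length) hne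
  obtain ⟨w, C', hC', hCS⟩ := hins.exists_isCycle
  refine ⟨w, C', hC, hC', ?_, y, ?_⟩
  · rw [HamChordal.length_eq_ncard_of_isCycle hC', hCS, hlen, Set.ncard_insert_of_notMem hy]
  · rw [hCS, Set.insert_sdiff_of_notMem _ hy, Set.sdiff_self]
    exact insert_empty_eq y
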